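/- Let $q \ge 3$ be an integer, let $\mathcal{P} = \{\nu \in \mathbb{R}^q : \nu_i \ge 0 \text{ for all } i,\ \sum_{i=1}^q \nu_i = 1\}$, let $\rho = (\frac1q, \ldots, \frac1q)$, and for $\nu \in \mathcal{P}$ put $R(\nu|\rho) = \sum_{i=1}^q \nu_i \log(q\nu_i)$ (with $0\log 0 = 0$). For $\beta \in \mathbb{R}$ the set of canonical equilibrium macrostates of the $q$-state Curie–Weiss–Potts model is $$\mathcal{E}_\beta = \left\{\nu \in \mathcal{P} : \nu \text{ minimizes } R(\nu|\rho) - \tfrac{\beta}{2}\langle \nu, \nu\rangle \text{ over } \mathcal{P}\right\}.$$ Let $$\beta_c = \frac{2(q-1)}{q-2}\log(q-1) > 0, \qquad \psi(w) = \left(\frac{1+(q-1)w}{q}, \frac{1-w}{q}, \ldots, \frac{1-w}{q}\right) \in \mathbb{R}^q,$$ where the last $q-1$ components of $\psi(w)$ all equal $\frac{1-w}{q}$. For $\beta > 0$ let $w(\beta)$ be the largest real solution $w$ of $$w = \frac{1-e^{-\beta w}}{1+(q-1)e^{-\beta w}}.$$ Then the following hold. (a) For every $\beta > 0$, $w(\beta)$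 is well defined (a largest solution exists) and lies in $[0,1]$. On $(\beta_c, \infty)$ the function $w$ is positive, strictly increasing and differentiable. Moreover $w(\beta_c) = \frac{q-2}{q-1}$ and $\lim_{\beta\to\infty} w(\beta) = 1$. (b) For $\beta \ge \beta_c$ let $\nu^1(\beta) = \psi(w(\beta))$ and, for $i = 2, \ldots, q$, let $\nu^i(\beta)$ be the vector obtained by interchanging the first and the $i$-th components of $\nu^1(\beta)$. Then, for all $\beta \in \mathbb{R}$ (in particular for all $\beta \le 0$, where the first case applies), $$\mathcal{E}_\beta = \begin{cases} \{\rho\} & \text{for } \beta < \beta_c, \\ \{\rho, \nu^1(\beta_c), \nu^2(\beta_c), \ldots, \nu^q(\beta_c)\} & \text{for } \beta = \beta_c, \\ \{\nu^1(\beta), \nu^2(\beta), \ldots, \nu^q(\beta)\} & \text{for } \beta > \beta_c. \end{cases}$$ For $\beta \ge \beta_c$ the vectors listed for $\mathcal{E}_\beta$ are all distinct ($q+1$ vectors at $\beta = \beta_c$, and $q$ vectors for $\beta > \beta_c$), and each $\nu^i$ is a continuous function of $\beta \in [\beta_c, \infty)$. Finally, $$\nu^1(\beta_c) = \psi(w(\beta_c))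 = \psi\!\left(\frac{q-2}{q-1}\right) = \left(1-\frac1q, \frac{1}{q(q-1)}, \ldots, \frac{1}{q(q-1)}\right),$$ where the last $q-1$ components all equal $\frac{1}{q(q-1)}$. -/

import Mathlib

open Set Filter Topology

noncomputable section

namespace CurieWeissPotts

/-- The relative entropy `R(ν|ρ) = ∑ i, ν i * log (q * ν i)` of a probability vector `ν` with
respect to the uniform vector (with `0 log 0 = 0`, since `Real.log 0 = 0`). -/
def relEntropy (q : ℕ) (ν : Fin q → ℝ) : ℝ :=
  ∑ i, ν i * Real.log (q * ν i)

/-- The functional `ν ↦ R(ν|ρ) - (β / 2) ⟨ν, ν⟩`. -/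
def freeEnergy (q : ℕ) (β : ℝ) (ν : Fin q → ℝ) : ℝ :=
  relEntropy q ν - β / 2 * ∑ i, ν i * ν i

/-- The set of canonical equilibrium macrostates: the probability vectors on `q` points that
minimize `R(ν|ρ) - (β / 2) ⟨ν, ν⟩` over all probability vectors. -/
def canonicalMacrostates (q : ℕ) (β : ℝ) : Set (Fin q → ℝ) :=
  {ν | ν ∈ stdSimplex ℝ (Fin q) ∧ ∀ μ ∈ stdSimplex ℝ (Fin q), freeEnergy q β ν ≤ freeEnergy q β μ}

/-- The uniform probability vector `ρ`. -/
def uniformVec (q : ℕ) : Fin q → ℝ := fun _ => 1 / q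

/-- The critical inverse temperature. -/
def criticalBeta (q : ℕ) : ℝ :=
  2 * ((q : ℝ) - 1) / ((q : ℝ) - 2) * Real.log ((q : ℝ) - 1)

/-- The set of all real solutions `w` of the mean-field equation. -/
def meanFieldSolutions (q : ℕ) (β : ℝ) : Set ℝ :=
  {w | w = (1 - Real.exp (-β * w)) / (1 + ((q : ℝ) - 1) * Real.exp (-β * w))}

/-- The largest solution of the mean-field equation. It is defined as a supremum; that it is
attained (so that it really is the largest solution) has to be proved. -/
def largestSolution (q : ℕ) (β : ℝ) : ℝ := sSup (meanFieldSolutions q β)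

/-- `ψ(w) = ((1 + (q - 1) w) / q, (1 - w) / q, …, (1 - w) / q)`. -/
def psi (q : ℕ) [NeZero q] (w : ℝ) : Fin q → ℝ :=
  fun j => if j = 0 then (1 + ((q : ℝ) - 1) * w) / q else (1 - w) / q

/-- The vector obtained from `ψ(w(β))` by interchanging its first and its `i`-th component
(components are numbered from `0`, so `i = 0` gives `ψ(w(β))` itself). -/
def orderedVec (q : ℕ) [NeZero q] (i : Fin q) (β : ℝ) : Fin q → ℝ :=
  fun j => psi q (largestSolution q β) (Equiv.swap 0 i j)

end CurieWeissPotts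

end

open CurieWeissPotts

/-! Put c = (q-2)/(q-1). For 0 < w < 1 the mean-field equation says β = `betaOf q w`, and `betaOf q`
is strictly increasing on [c, 1) with value β_c at c (`strictMonoOn_betaOf`, resting on sinh t > t).
Hence w(β) for β ≥ β_c is the inverse of this function, which gives all of (a).

For (b) with β > 0, moving mass between two sites shows that a minimizer has positive components and
that log x - βx takes one common value on them. This function rises up to 1/β and falls afterwards,
and strict concavity of the site energy forbids two equal components above 1/β. So a minimizer is
uniform or a transposed ψ(w) with `betaOf q w = β` (`eq_uniformVec_or_psi_of_mem`).

It remains to study the energy `profile` of ψ(w) relative to ρ. At β_c it is symmetric under w ↦ c -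
w, vanishes at 0 and c, and is positive elsewhere on [0, 1) (`profile_pos`). Other β are compared
with β_c, the energies differing by a multiple of ⟨ν, ν⟩: below β_c this favours ρ, and above it
only w ≥ c survives, hence w = w(β). Existence by compactness turns these necessary conditions into
equalities of sets. -/

namespace CurieWeissPotts

/-! ### Monotonicity of the inverse temperature as a function of w -/

/-- The logarithm of the ratio of the two values taken by `ψ(w)`. -/
noncomputable def logRatio (r w : ℝ) : ℝ := Real.log (1 + (r - 1) * w) - Real.log (1 - w)

/-- The inverse temperature at which `w ≠ 0` solves the mean-field equation. -/
noncomputable def betaOf (r w : ℝ) : ℝ := logRatio r w / w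

lemma one_add_pos {r w : ℝ} (hr : 2 < r) (hw : 0 ≤ w) : 0 < 1 + (r - 1) * w := by
  have : 0 ≤ (r - 1) * w := mul_nonneg (by linarith) hw
  linarith

lemma hasDerivAt_logRatio {r w : ℝ} (h1 : 0 < 1 + (r - 1) * w) (h2 : w < 1) :
    HasDerivAt (logRatio r) (r / ((1 + (r - 1) * w) * (1 - w))) w := by
  have h3 : 0 < 1 - w := by linarith
  have a : HasDerivAt (fun w : ℝ => 1 + (r - 1) * w) (r - 1) w := by
    simpa using ((hasDerivAt_id w).const_mul (r - 1)).const_add 1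
  have b : HasDerivAt (fun w : ℝ => 1 - w) (-1) w := by
    simpa using (hasDerivAt_id w).const_sub 1
  refine ((a.log h1.ne').sub (b.log h3.ne')).congr_deriv ?_
  field_simp
  ring

/-- With x = a², y = b² and t = log (a/b) > 0, the bound t < sinh t reads 2t < (a² - b²)/(ab); since
ab ≤ 1, replacing ab by (ab)² only enlarges the right side. -/
lemma log_sub_log_lt {x y : ℝ} (hy : 0 < y) (hyx : y < x) (hxy : x * y ≤ 1) :
    Real.log x - Real.log y < (x - y) / (x * y) := by
  have hx : 0 < x := hy.trans hyx
  obtain ⟨a, ha, rfl⟩ : ∃ a : ℝ, 0 < a ∧ x = a ^ 2 :=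
    ⟨√x, Real.sqrt_pos.2 hx, (Real.sq_sqrt hx.le).symm⟩
  obtain ⟨b, hb, rfl⟩ : ∃ b : ℝ, 0 < b ∧ y = b ^ 2 :=
    ⟨√y, Real.sqrt_pos.2 hy, (Real.sq_sqrt hy.le).symm⟩
  have hba : b < a := lt_of_pow_lt_pow_left₀ 2 ha.le hyx
  have hab : a * b ≤ 1 := by
    have : (a * b) ^ 2 ≤ 1 := by linarith [mul_pow a b 2]
    exact (sq_le_one_iff₀ (by positivity)).1 this
  have hlog : 0 < Real.log a - Real.log b := sub_pos.2 (Real.log_lt_log hb hba)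
  have hs := Real.self_lt_sinh_iff.2 hlog
  have he : Real.sinh (Real.log a - Real.log b) = (a ^ 2 - b ^ 2) / (2 * (a * b)) := by
    rw [← Real.log_div ha.ne' hb.ne', Real.sinh_log (by positivity)]
    field_simp
  rw [he] at hs
  have hle : (a ^ 2 - b ^ 2) / (a * b) ≤ (a ^ 2 - b ^ 2) / (a ^ 2 * b ^ 2) := by
    apply div_le_div_of_nonneg_left (by linarith) (by positivity)
    have := mul_le_mul_of_nonneg_left hab (by positivity : 0 ≤ a * b)
    linarith [mul_pow a b 2, sq (a * b)]
  have h2 : (a ^ 2 - b ^ 2) / (2 * (a * b)) = (a ^ 2 - b ^ 2) / (a * b) / 2 := by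
    field_simp
  rw [Real.log_pow, Real.log_pow]
  push_cast
  linarith

lemma critW_pos {r : ℝ} (hr : 2 < r) : 0 < (r - 2) / (r - 1) :=
  div_pos (by linarith) (by linarith)

lemma critW_lt_one {r : ℝ} (hr : 2 < r) : (r - 2) / (r - 1) < 1 := by
  rw [div_lt_one (by linarith)]
  linarith

/-- This is positivity of the numerator of `betaOf`'s derivative. The product (1 + (r-1)w)(1-w)
equals 1 + w((r-2) - (r-1)w), so for w > 0 it is at most 1 exactly when w ≥ (r-2)/(r-1). -/
lemma logRatio_lt_deriv_mul {r w : ℝ} (hr : 2 < r) (hw : w ∈ Ico ((r - 2) / (r - 1)) 1) :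
    logRatio r w < r / ((1 + (r - 1) * w) * (1 - w)) * w := by
  have hw0 : 0 < w := (critW_pos hr).trans_le hw.1
  have h2 : r - 2 ≤ w * (r - 1) := (div_le_iff₀ (by linarith)).1 hw.1
  have h := log_sub_log_lt (x := 1 + (r - 1) * w) (y := 1 - w) (by linarith [hw.2])
    (by nlinarith) (by nlinarith)
  calc logRatio r w < _ := h
    _ = _ := by ring

lemma hasDerivAt_betaOf {r w : ℝ} (hr : 2 < r) (hw0 : 0 < w) (hw1 : w < 1) :
    HasDerivAt (betaOf r)
      ((r / ((1 + (r - 1) * w) * (1 - w)) * w - logRatio r w * 1) / w ^ 2) w :=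
  (hasDerivAt_logRatio (one_add_pos hr hw0.le) hw1).div (hasDerivAt_id w) hw0.ne'

lemma betaOf_deriv_pos {r w : ℝ} (hr : 2 < r) (hw : w ∈ Ico ((r - 2) / (r - 1)) 1) :
    0 < (r / ((1 + (r - 1) * w) * (1 - w)) * w - logRatio r w * 1) / w ^ 2 := by
  have hw0 : 0 < w := (critW_pos hr).trans_le hw.1
  have := logRatio_lt_deriv_mul hr hw
  exact div_pos (by linarith) (by positivity)

lemma strictMonoOn_betaOf {r : ℝ} (hr : 2 < r) :
    StrictMonoOn (betaOf r) (Ico ((r - 2) / (r - 1)) 1) := by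
  have hpos : ∀ w ∈ Ico ((r - 2) / (r - 1)) 1, 0 < w := fun w hw => (critW_pos hr).trans_le hw.1
  apply strictMonoOn_of_deriv_pos (convex_Ico _ _)
  · exact fun w hw => (hasDerivAt_betaOf hr (hpos w hw) hw.2).continuousAt.continuousWithinAt
  · intro w hw
    have hw := interior_subset hw
    rw [(hasDerivAt_betaOf hr (hpos w hw) hw.2).deriv]
    exact betaOf_deriv_pos hr hw

lemma logRatio_critW {r : ℝ} (hr : 2 < r) :
    logRatio r ((r - 2) / (r - 1)) = 2 * Real.log (r - 1) := by
  have h1 : r - 1 ≠ 0 := by linarith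
  have e1 : 1 + (r - 1) * ((r - 2) / (r - 1)) = r - 1 := by field_simp; ring
  have e2 : 1 - (r - 2) / (r - 1) = (r - 1)⁻¹ := by field_simp; ring
  rw [logRatio, e1, e2, Real.log_inv]
  ring

lemma two_lt_cast {q : ℕ} (hq : 3 ≤ q) : (2 : ℝ) < q := by
  exact_mod_cast hq

lemma betaOf_critW {q : ℕ} (hq : 3 ≤ q) :
    betaOf q (((q : ℝ) - 2) / ((q : ℝ) - 1)) = criticalBeta q := by
  have hr := two_lt_cast hq
  have h1 : (q : ℝ) - 1 ≠ 0 := by linarith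
  have h2 : (q : ℝ) - 2 ≠ 0 := by linarith
  rw [betaOf, logRatio_critW hr, criticalBeta]
  field_simp

lemma criticalBeta_pos {q : ℕ} (hq : 3 ≤ q) : 0 < criticalBeta q := by
  have hr := two_lt_cast hq
  have : 0 < Real.log ((q : ℝ) - 1) := Real.log_pos (by linarith)
  have : 0 < (q : ℝ) - 1 := by linarith
  have : 0 < (q : ℝ) - 2 := by linarith
  unfold criticalBeta
  positivity

lemma criticalBeta_mul {q : ℕ} (hq : 3 ≤ q) :
    criticalBeta q * (((q : ℝ) - 2) / ((q : ℝ) - 1)) = 2 * Real.log ((q : ℝ) - 1) := by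
  have hr := two_lt_cast hq
  rw [← betaOf_critW hq, betaOf, logRatio_critW hr, div_mul_cancel₀ _ (critW_pos hr).ne']

/-! ### The largest solution w(β) and its regularity -/

lemma mem_meanFieldSolutions_iff {q : ℕ} (hq : 3 ≤ q) {β w : ℝ} :
    w ∈ meanFieldSolutions q β ↔ Real.exp (-β * w) * (1 + ((q : ℝ) - 1) * w) = 1 - w := by
  have hr := two_lt_cast hq
  have : 0 < 1 + ((q : ℝ) - 1) * Real.exp (-β * w) := one_add_pos hr (Real.exp_pos _).le
  rw [meanFieldSolutions, mem_ofPred_eq, eq_div_iff this.ne']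
  constructor <;> intro h <;> linarith

lemma mem_meanFieldSolutions_iff_logRatio {q : ℕ} (hq : 3 ≤ q) {β w : ℝ} (hw0 : 0 ≤ w)
    (hw1 : w < 1) : w ∈ meanFieldSolutions q β ↔ logRatio q w = β * w := by
  have h1 := one_add_pos (two_lt_cast hq) hw0
  have h2 : 0 < 1 - w := by linarith
  rw [mem_meanFieldSolutions_iff hq, logRatio, ← Real.log_div h1.ne' h2.ne', neg_mul, Real.exp_neg,
    inv_mul_eq_iff_eq_mul₀ (Real.exp_pos _).ne', ← div_eq_iff h2.ne']
  constructor
  · intro h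
    rw [h, Real.log_exp]
  · intro h
    rw [← h, Real.exp_log (by positivity)]

lemma zero_mem_meanFieldSolutions (q : ℕ) (β : ℝ) : (0 : ℝ) ∈ meanFieldSolutions q β := by
  simp [meanFieldSolutions]

lemma lt_one_of_mem_meanFieldSolutions {q : ℕ} (hq : 3 ≤ q) {β w : ℝ}
    (hw : w ∈ meanFieldSolutions q β) : w < 1 := by
  have hr := two_lt_cast hq
  by_contra! h
  have h1 := mul_pos (Real.exp_pos (-β * w)) (one_add_pos hr (zero_le_one.trans h))
  rw [mem_meanFieldSolutions_iff hq] at hw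
  linarith

lemma isClosed_meanFieldSolutions {q : ℕ} (hq : 3 ≤ q) (β : ℝ) :
    IsClosed (meanFieldSolutions q β) := by
  have : meanFieldSolutions q β =
      {w | Real.exp (-β * w) * (1 + ((q : ℝ) - 1) * w) = 1 - w} := by
    ext w
    exact mem_meanFieldSolutions_iff hq
  rw [this]
  exact isClosed_eq (by fun_prop) (by fun_prop)

lemma isGreatest_largestSolution {q : ℕ} (hq : 3 ≤ q) (β : ℝ) :
    IsGreatest (meanFieldSolutions q β) (largestSolution q β) := by
  have hb : BddAbove (meanFieldSolutions q β) :=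
    ⟨1, fun w hw => (lt_one_of_mem_meanFieldSolutions hq hw).le⟩
  exact ⟨(isClosed_meanFieldSolutions hq β).csSup_mem ⟨0, zero_mem_meanFieldSolutions q β⟩ hb,
    fun w hw => le_csSup hb hw⟩

lemma largestSolution_mem_Ico {q : ℕ} (hq : 3 ≤ q) (β : ℝ) : largestSolution q β ∈ Ico (0 : ℝ) 1 :=
  ⟨(isGreatest_largestSolution hq β).2 (zero_mem_meanFieldSolutions q β),
    lt_one_of_mem_meanFieldSolutions hq (isGreatest_largestSolution hq β).1⟩

lemma exists_ge_critW_mem_meanFieldSolutions {q : ℕ} (hq : 3 ≤ q) {β : ℝ}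
    (hβ : criticalBeta q ≤ β) :
    ∃ w ∈ meanFieldSolutions q β, ((q : ℝ) - 2) / ((q : ℝ) - 1) ≤ w := by
  have hr := two_lt_cast hq
  set c := ((q : ℝ) - 2) / ((q : ℝ) - 1) with hc
  have hc1 : c < 1 := critW_lt_one hr
  have h1 : 0 < (q : ℝ) - 1 := by linarith
  let K : ℝ → ℝ := fun w => 1 - w - Real.exp (-β * w) * (1 + ((q : ℝ) - 1) * w)
  have hK : ContinuousOn K (Icc c 1) := by fun_prop
  have hK1 : K 1 ≤ 0 := by
    have := mul_pos (Real.exp_pos (-β * 1)) (one_add_pos hr zero_le_one)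
    simp only [K]
    linarith
  have hKc : 0 ≤ K c := by
    have e1 : 1 + ((q : ℝ) - 1) * c = q - 1 := by rw [hc]; field_simp; ring
    have e2 : 1 - c = ((q : ℝ) - 1)⁻¹ := by rw [hc]; field_simp; ring
    -- Since β_c · c = 2 log (q-1), the value β = β_c is where this bound, and hence K c ≥ 0, is
    -- sharp.
    have e3 : Real.exp (-β * c) ≤ (((q : ℝ) - 1) ^ 2)⁻¹ := by
      have hm := mul_le_mul_of_nonneg_right hβ (critW_pos hr).le
      rw [criticalBeta_mul hq] at hm
      have : Real.exp (-(2 * Real.log ((q : ℝ) - 1))) = (((q : ℝ) - 1) ^ 2)⁻¹ := by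
        rw [Real.exp_neg, two_mul, Real.exp_add, Real.exp_log h1, sq]
      rw [← this]
      exact Real.exp_le_exp.2 (by rw [neg_mul]; exact neg_le_neg hm)
    have e4 := mul_le_mul_of_nonneg_right e3 h1.le
    have e5 : (((q : ℝ) - 1) ^ 2)⁻¹ * (q - 1) = ((q : ℝ) - 1)⁻¹ := by field_simp
    simp only [K, e1, e2]
    linarith
  obtain ⟨w, hw, hw0⟩ := intermediate_value_Icc' hc1.le hK ⟨hK1, hKc⟩
  refine ⟨w, (mem_meanFieldSolutions_iff hq).2 ?_, hw.1⟩
  simp only [K] at hw0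
  linarith

lemma largestSolution_mem {q : ℕ} (hq : 3 ≤ q) {β : ℝ} (hβ : criticalBeta q ≤ β) :
    largestSolution q β ∈ Ico (((q : ℝ) - 2) / ((q : ℝ) - 1)) 1 := by
  obtain ⟨w, hw, hcw⟩ := exists_ge_critW_mem_meanFieldSolutions hq hβ
  exact ⟨hcw.trans ((isGreatest_largestSolution hq β).2 hw), (largestSolution_mem_Ico hq β).2⟩

lemma betaOf_largestSolution {q : ℕ} (hq : 3 ≤ q) {β : ℝ} (hβ : criticalBeta q ≤ β) :
    betaOf q (largestSolution q β) = β := by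
  have hm := largestSolution_mem hq hβ
  have h0 := (critW_pos (two_lt_cast hq)).trans_le hm.1
  rw [betaOf, div_eq_iff h0.ne']
  exact (mem_meanFieldSolutions_iff_logRatio hq h0.le hm.2).1 (isGreatest_largestSolution hq β).1

lemma eq_largestSolution {q : ℕ} (hq : 3 ≤ q) {β w : ℝ} (hβ : criticalBeta q ≤ β)
    (hw : w ∈ Ico (((q : ℝ) - 2) / ((q : ℝ) - 1)) 1) (h : betaOf q w = β) :
    w = largestSolution q β :=
  (strictMonoOn_betaOf (two_lt_cast hq)).injOn hw (largestSolution_mem hq hβ)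
    (h.trans (betaOf_largestSolution hq hβ).symm)

lemma largestSolution_criticalBeta {q : ℕ} (hq : 3 ≤ q) :
    largestSolution q (criticalBeta q) = ((q : ℝ) - 2) / ((q : ℝ) - 1) :=
  (eq_largestSolution hq le_rfl ⟨le_rfl, critW_lt_one (two_lt_cast hq)⟩ (betaOf_critW hq)).symm

/-- Order comparisons with w(β) become comparisons of β with `betaOf`; monotonicity, continuity and
the limit at infinity are read off from this. -/
lemma lt_largestSolution_iff {q : ℕ} (hq : 3 ≤ q) {β w : ℝ} (hβ : criticalBeta q ≤ β)
    (hw : w ∈ Ico (((q : ℝ) - 2) / ((q : ℝ) - 1)) 1) :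
    w < largestSolution q β ↔ betaOf q w < β := by
  rw [← (strictMonoOn_betaOf (two_lt_cast hq)).lt_iff_lt hw (largestSolution_mem hq hβ),
    betaOf_largestSolution hq hβ]

lemma largestSolution_lt_iff {q : ℕ} (hq : 3 ≤ q) {β w : ℝ} (hβ : criticalBeta q ≤ β)
    (hw : w ∈ Ico (((q : ℝ) - 2) / ((q : ℝ) - 1)) 1) :
    largestSolution q β < w ↔ β < betaOf q w := by
  rw [← (strictMonoOn_betaOf (two_lt_cast hq)).lt_iff_lt (largestSolution_mem hq hβ) hw,
    betaOf_largestSolution hq hβ]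

lemma strictMonoOn_largestSolution {q : ℕ} (hq : 3 ≤ q) :
    StrictMonoOn (largestSolution q) (Ici (criticalBeta q)) := by
  intro β hβ β' hβ' h
  rw [lt_largestSolution_iff hq hβ' (largestSolution_mem hq hβ), betaOf_largestSolution hq hβ]
  exact h

lemma continuousOn_largestSolution {q : ℕ} (hq : 3 ≤ q) :
    ContinuousOn (largestSolution q) (Ici (criticalBeta q)) := by
  intro β hβ
  have hm := largestSolution_mem hq hβ
  refine tendsto_order.2 ⟨fun u hu => ?_, fun u hu => ?_⟩
  · rcases lt_or_ge u (((q : ℝ) - 2) / ((q : ℝ) - 1)) with huc | huc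
    · filter_upwards [self_mem_nhdsWithin] with b hb
      exact huc.trans_le (largestSolution_mem hq hb).1
    · have hum : u ∈ Ico (((q : ℝ) - 2) / ((q : ℝ) - 1)) 1 := ⟨huc, hu.trans hm.2⟩
      filter_upwards [self_mem_nhdsWithin, mem_nhdsWithin_of_mem_nhds
        (Ioi_mem_nhds ((lt_largestSolution_iff hq hβ hum).1 hu))] with b hb hb'
      exact (lt_largestSolution_iff hq hb hum).2 hb'
  · rcases lt_or_ge u 1 with hu1 | hu1
    · have hum : u ∈ Ico (((q : ℝ) - 2) / ((q : ℝ) - 1)) 1 := ⟨hm.1.trans hu.le, hu1⟩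
      filter_upwards [self_mem_nhdsWithin, mem_nhdsWithin_of_mem_nhds
        (Iio_mem_nhds ((largestSolution_lt_iff hq hβ hum).1 hu))] with b hb hb'
      exact (largestSolution_lt_iff hq hb hum).2 hb'
    · filter_upwards [self_mem_nhdsWithin] with b hb
      exact (largestSolution_mem hq hb).2.trans_le hu1

lemma differentiableAt_largestSolution {q : ℕ} (hq : 3 ≤ q) {β : ℝ} (hβ : criticalBeta q < β) :
    DifferentiableAt ℝ (largestSolution q) β := by
  have hr := two_lt_cast hq
  have hm := largestSolution_mem hq hβ.le
  have h := hasDerivAt_betaOf hr ((critW_pos hr).trans_le hm.1) hm.2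
  refine (HasDerivAt.of_local_left_inverse
    ((continuousOn_largestSolution hq).continuousAt (Ici_mem_nhds hβ)) h
    (betaOf_deriv_pos hr hm).ne' ?_).differentiableAt
  filter_upwards [Ici_mem_nhds hβ] with b hb
  exact betaOf_largestSolution hq hb

lemma tendsto_largestSolution {q : ℕ} (hq : 3 ≤ q) :
    Tendsto (largestSolution q) atTop (𝓝 1) := by
  refine tendsto_order.2 ⟨fun u hu => ?_, fun u hu => ?_⟩
  · have hum : max u (((q : ℝ) - 2) / ((q : ℝ) - 1)) ∈ Ico (((q : ℝ) - 2) / ((q : ℝ) - 1)) 1 :=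
      ⟨le_max_right _ _, max_lt hu (critW_lt_one (two_lt_cast hq))⟩
    filter_upwards [eventually_ge_atTop (criticalBeta q), eventually_gt_atTop (betaOf q _)]
      with b hb hb'
    exact (le_max_left _ _).trans_lt ((lt_largestSolution_iff hq hb hum).2 hb')
  · exact Eventually.of_forall fun b => (largestSolution_mem_Ico hq b).2.trans hu

/-! ### The energy along ψ(w) -/

/-- The free energy of `ψ(w)` relative to that of the uniform vector. -/
noncomputable def profile (r b w : ℝ) : ℝ :=
  ((1 + (r - 1) * w) * Real.log (1 + (r - 1) * w)
    + (r - 1) * ((1 - w) * Real.log (1 - w))) / r - b * (r - 1) / (2 * r) * w ^ 2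

lemma hasDerivAt_profile {r w : ℝ} (b : ℝ) (hr : 2 < r) (hw0 : 0 ≤ w) (hw1 : w < 1) :
    HasDerivAt (profile r b) ((r - 1) / r * (logRatio r w - b * w)) w := by
  have h1 := one_add_pos hr hw0
  have h3 : 0 < 1 - w := by linarith
  have a : HasDerivAt (fun w : ℝ => 1 + (r - 1) * w) (r - 1) w := by
    simpa using ((hasDerivAt_id w).const_mul (r - 1)).const_add 1
  have b' : HasDerivAt (fun w : ℝ => 1 - w) (-1) w := by
    simpa using (hasDerivAt_id w).const_sub 1
  have h := (((a.mul (a.log h1.ne')).add ((b'.mul (b'.log h3.ne')).const_mul (r - 1))).div_const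
    r).sub ((hasDerivAt_pow 2 w).const_mul (b * (r - 1) / (2 * r)))
  refine h.congr_deriv ?_
  have hr0 : r ≠ 0 := by linarith
  rw [logRatio]
  field_simp
  push_cast
  ring

/-- The quadratic (1 + (r-1)w)(1-w) has its vertex at half of (r-2)/(r-1), so to the right of it the
derivative r/((1 + (r-1)w)(1-w)) - b increases. -/
lemma strictConvexOn_logRatio_sub {r : ℝ} (b : ℝ) (hr : 2 < r) :
    StrictConvexOn ℝ (Ico ((r - 2) / (r - 1) / 2) 1) (fun w => logRatio r w - b * w) := by
  have hc := critW_pos hr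
  have hd : ∀ w ∈ Ico ((r - 2) / (r - 1) / 2) 1, HasDerivAt (fun w => logRatio r w - b * w)
      (r / ((1 + (r - 1) * w) * (1 - w)) - b) w := by
    intro w hw
    exact ((hasDerivAt_logRatio (one_add_pos hr (by linarith [hw.1])) hw.2).sub
      ((hasDerivAt_id w).const_mul b)).congr_deriv (by rw [mul_one])
  refine StrictMonoOn.strictConvexOn_of_deriv (convex_Ico _ _)
    (fun w hw => (hd w hw).continuousAt.continuousWithinAt) ?_
  intro u hu v hv huv
  have hu := interior_subset hu
  have hv := interior_subset hv
  rw [(hd u hu).deriv, (hd v hv).deriv]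
  have hu2 : r - 2 ≤ 2 * u * (r - 1) := by
    have := hu.1
    rw [div_div, div_le_iff₀ (by linarith)] at this
    linarith
  have hvp : 0 < (1 + (r - 1) * v) * (1 - v) :=
    mul_pos (one_add_pos hr (by linarith [hv.1])) (by linarith [hv.2])
  have hlt : (1 + (r - 1) * v) * (1 - v) < (1 + (r - 1) * u) * (1 - u) := by
    have : 0 < (v - u) * ((r - 1) * (u + v) - (r - 2)) :=
      mul_pos (by linarith) (by nlinarith)
    linarith
  have := div_lt_div_of_pos_left (show 0 < r by linarith) hvp hlt
  linarith

lemma logRatio_half_critW {r : ℝ} (hr : 2 < r) :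
    logRatio r ((r - 2) / (r - 1) / 2) = Real.log (r - 1) := by
  have h1 : r - 1 ≠ 0 := by linarith
  have h0 : r ≠ 0 := by linarith
  have e1 : 1 + (r - 1) * ((r - 2) / (r - 1) / 2) = r / 2 := by field_simp; ring
  have e2 : 1 - (r - 2) / (r - 1) / 2 = r / 2 / (r - 1) := by field_simp; ring
  rw [logRatio, e1, e2, Real.log_div (x := r / 2) (by positivity) h1]
  ring

/-- Up to factors r-1, the reflection exchanges 1 + (r-1)w and 1-w. The resulting log (r-1) terms
cancel the change of the quadratic term because of `hb`. -/
lemma profile_symm {r b w : ℝ} (hr : 2 < r) (hb : b * ((r - 2) / (r - 1)) = 2 * Real.log (r - 1))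
    (hw0 : 0 ≤ w) (hw1 : w < 1) : profile r b ((r - 2) / (r - 1) - w) = profile r b w := by
  have h1 : r - 1 ≠ 0 := by linarith
  have h0 : r ≠ 0 := by linarith
  have hx := (one_add_pos hr hw0).ne'
  have hy : 1 - w ≠ 0 := by linarith
  have e1 : 1 + (r - 1) * ((r - 2) / (r - 1) - w) = (r - 1) * (1 - w) := by field_simp; ring
  have e2 : 1 - ((r - 2) / (r - 1) - w) = (1 + (r - 1) * w) / (r - 1) := by field_simp; ring
  have e3 : b * (r - 1) / (2 * r) * ((r - 2) / (r - 1) - w) ^ 2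
      = b * (r - 1) / (2 * r) * w ^ 2
        + b * ((r - 2) / (r - 1)) * ((r - 2) - 2 * (r - 1) * w) / (2 * r) := by
    field_simp; ring
  rw [profile, profile, e3, hb, e1, e2, Real.log_mul h1 hy, Real.log_div hx h1]
  field_simp
  ring

lemma profile_zero (r b : ℝ) : profile r b 0 = 0 := by
  simp [profile]

lemma profile_critW {r b : ℝ} (hr : 2 < r)
    (hb : b * ((r - 2) / (r - 1)) = 2 * Real.log (r - 1)) :
    profile r b ((r - 2) / (r - 1)) = 0 := by
  have := profile_symm hr hb (critW_pos hr).le (critW_lt_one hr)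
  rwa [sub_self, profile_zero, eq_comm] at this

/-- On [c/2, 1) the derivative is a positive multiple of a strictly convex function with zeros c/2
and c, so the profile falls to its value 0 at c and then rises. Symmetry covers w < c/2. -/
lemma profile_pos {r b w : ℝ} (hr : 2 < r) (hb : b * ((r - 2) / (r - 1)) = 2 * Real.log (r - 1))
    (hw0 : 0 < w) (hw1 : w < 1) (hwc : w ≠ (r - 2) / (r - 1)) : 0 < profile r b w := by
  have hcrit := profile_critW hr hb
  have hsymm := profile_symm hr hb hw0.le hw1
  have hD := strictConvexOn_logRatio_sub b hr
  have hDc : logRatio r ((r - 2) / (r - 1)) - b * ((r - 2) / (r - 1)) = 0 := by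
    rw [logRatio_critW hr, hb, sub_self]
  have hDh : logRatio r ((r - 2) / (r - 1) / 2) - b * ((r - 2) / (r - 1) / 2) = 0 := by
    rw [logRatio_half_critW hr]
    linarith
  have hder := fun w => hasDerivAt_profile (w := w) b hr
  have hc0 := critW_pos hr
  have hc1 := critW_lt_one hr
  have hk : 0 < (r - 1) / r := div_pos (by linarith) (by linarith)
  set c := (r - 2) / (r - 1)
  have hmh : c / 2 ∈ Ico (c / 2) 1 := ⟨le_rfl, by linarith⟩
  have hanti : StrictAntiOn (profile r b) (Icc (c / 2) c) := by
    apply strictAntiOn_of_deriv_neg (convex_Icc _ _)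
    · exact fun u hu => (hder u (by linarith [hu.1])
        (hu.2.trans_lt hc1)).continuousAt.continuousWithinAt
    · intro u hu
      rw [interior_Icc] at hu
      rw [(hder u (by linarith [hu.1]) (hu.2.trans hc1)).deriv]
      apply mul_neg_of_pos_of_neg hk
      -- A nonnegative value at u would make the chord slope from c/2 to u nonnegative and from u to
      -- c nonpositive, against strict convexity.
      by_contra! hneg
      have := hD.slope_strict_mono_adjacent hmh ⟨by linarith, hc1⟩ hu.1 hu.2
      simp only [hDc, hDh] at this
      have h1 := div_nonneg hneg (sub_nonneg.2 hu.1.le)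
      have h2 := div_nonneg hneg (sub_nonneg.2 hu.2.le)
      rw [sub_zero, zero_sub, neg_div] at this
      linarith
  have hmono : StrictMonoOn (profile r b) (Ico c 1) := by
    apply strictMonoOn_of_deriv_pos (convex_Ico _ _)
    · exact fun u hu => (hder u (by linarith [hu.1]) hu.2).continuousAt.continuousWithinAt
    · intro u hu
      rw [interior_Ico] at hu
      rw [(hder u (by linarith [hu.1]) hu.2).deriv]
      apply mul_pos hk
      have := hD.slope_strict_mono_adjacent hmh ⟨by linarith [hu.1], hu.2⟩
        (show c / 2 < c by linarith) hu.1
      simp only [hDc, hDh, sub_self, zero_div, sub_zero] at this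
      exact (div_pos_iff_of_pos_right (sub_pos.2 hu.1)).1 this
  have key : ∀ u, c / 2 ≤ u → u < c → 0 < profile r b u := fun u h1 h2 => by
    rw [← hcrit]
    exact hanti ⟨h1, h2.le⟩ ⟨by linarith, le_rfl⟩ h2
  rcases lt_or_gt_of_ne hwc with h | h
  · rcases le_or_gt (c / 2) w with h2 | h2
    · exact key w h2 h
    · rw [← hsymm]
      exact key _ (by linarith) (by linarith)
  · rw [← hcrit]
    exact hmono ⟨le_rfl, hc1⟩ ⟨h.le, hw1⟩ h

lemma profile_eq_sub {r b b' w : ℝ} :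
    profile r b w = profile r b' w - (b - b') * (r - 1) / (2 * r) * w ^ 2 := by
  simp only [profile]
  ring

/-! ### Existence of minimizers and optimality conditions -/

/-- The contribution of one component to the free energy. -/
noncomputable def siteEnergy (q : ℕ) (β x : ℝ) : ℝ := x * Real.log (q * x) - β / 2 * (x * x)

lemma freeEnergy_eq_sum (q : ℕ) (β : ℝ) (ν : Fin q → ℝ) :
    freeEnergy q β ν = ∑ i, siteEnergy q β (ν i) := by
  simp only [freeEnergy, relEntropy, siteEnergy, Finset.sum_sub_distrib, Finset.mul_sum]

lemma continuous_siteEnergy {q : ℕ} [NeZero q] (β : ℝ) : Continuous (siteEnergy q β) := by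
  have hq : (q : ℝ) ≠ 0 := NeZero.ne _
  have h : siteEnergy q β = fun x => (q * x * Real.log (q * x)) / q - β / 2 * (x * x) := by
    funext x
    rw [siteEnergy]
    field_simp
  rw [h]
  have : Continuous fun x : ℝ => q * x * Real.log (q * x) :=
    Real.continuous_mul_log.comp (continuous_const.mul continuous_id)
  fun_prop

lemma continuous_freeEnergy {q : ℕ} [NeZero q] (β : ℝ) : Continuous (freeEnergy q β) := by
  have : freeEnergy q β = fun ν => ∑ i, siteEnergy q β (ν i) :=
    funext (freeEnergy_eq_sum q β)
  rw [this]
  exact continuous_finsetSum _ fun i _ => (continuous_siteEnergy β).comp (continuous_apply i)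

lemma uniformVec_mem_stdSimplex (q : ℕ) [NeZero q] : uniformVec q ∈ stdSimplex ℝ (Fin q) := by
  have hq : (q : ℝ) ≠ 0 := NeZero.ne _
  refine ⟨fun i => by simp only [uniformVec]; positivity, ?_⟩
  simp [uniformVec, hq]

lemma canonicalMacrostates_nonempty (q : ℕ) [NeZero q] (β : ℝ) :
    (canonicalMacrostates q β).Nonempty := by
  obtain ⟨ν, hν, h⟩ := (isCompact_stdSimplex (𝕜 := ℝ) (Fin q)).exists_isMinOn
    ⟨_, uniformVec_mem_stdSimplex q⟩ (continuous_freeEnergy β).continuousOn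
  exact ⟨ν, hν, fun μ hμ => h hμ⟩

lemma mem_canonicalMacrostates_of_le {q : ℕ} {β : ℝ} {ν μ : Fin q → ℝ}
    (hν : ν ∈ canonicalMacrostates q β) (hμ : μ ∈ stdSimplex ℝ (Fin q))
    (h : freeEnergy q β μ ≤ freeEnergy q β ν) : μ ∈ canonicalMacrostates q β :=
  ⟨hμ, fun κ hκ => h.trans (hν.2 κ hκ)⟩

lemma sum_comp_update {ι : Type*} [Fintype ι] [DecidableEq ι] (g : ℝ → ℝ) (ν : ι → ℝ) (i : ι)
    (x : ℝ) : ∑ k, g (Function.update ν i x k) = ∑ k, g (ν k) - g (ν i) + g x := by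
  rw [← Finset.add_sum_erase _ _ (Finset.mem_univ i),
    ← Finset.add_sum_erase _ (fun k => g (ν k)) (Finset.mem_univ i), Function.update_self]
  have : ∑ k ∈ Finset.univ.erase i, g (Function.update ν i x k)
      = ∑ k ∈ Finset.univ.erase i, g (ν k) :=
    Finset.sum_congr rfl fun k hk => by rw [Function.update_of_ne (Finset.ne_of_mem_erase hk)]
  rw [this]
  ring

/-- Transferring mass t from site j to site i stays in the simplex. Every optimality condition below
comes from this two-site inequality. -/
lemma siteEnergy_add_le_of_mem {q : ℕ} {β : ℝ} {ν : Fin q → ℝ}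
    (hν : ν ∈ canonicalMacrostates q β) {i j : Fin q} (hij : i ≠ j) {t : ℝ} (hi : 0 ≤ ν i + t)
    (hj : 0 ≤ ν j - t) :
    siteEnergy q β (ν i) + siteEnergy q β (ν j)
      ≤ siteEnergy q β (ν i + t) + siteEnergy q β (ν j - t) := by
  set μ := Function.update (Function.update ν i (ν i + t)) j (ν j - t) with hμ
  have hsum : ∀ g : ℝ → ℝ, ∑ k, g (μ k)
      = ∑ k, g (ν k) - g (ν i) - g (ν j) + g (ν i + t) + g (ν j - t) := by
    intro g
    rw [hμ, sum_comp_update, sum_comp_update, Function.update_of_ne hij.symm]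
    ring
  have hmem : μ ∈ stdSimplex ℝ (Fin q) := by
    refine ⟨fun k => ?_, ?_⟩
    · rcases eq_or_ne k j with rfl | hkj
      · simpa [hμ] using hj
      · rw [hμ, Function.update_of_ne hkj]
        rcases eq_or_ne k i with rfl | hki
        · simpa using hi
        · rw [Function.update_of_ne hki]
          exact hν.1.1 k
    · have := hsum id
      simp only [id] at this
      rw [this, hν.1.2]
      ring
  have h := hν.2 μ hmem
  rw [freeEnergy_eq_sum, freeEnergy_eq_sum, hsum] at h
  linarith

lemma hasDerivAt_siteEnergy {q : ℕ} [NeZero q] (β : ℝ) {x : ℝ} (hx : 0 < x) :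
    HasDerivAt (siteEnergy q β) (Real.log q + 1 + (Real.log x - β * x)) x := by
  have hq : (q : ℝ) ≠ 0 := NeZero.ne _
  have h1 : HasDerivAt (fun x : ℝ => (q : ℝ) * x) q x := by
    simpa using (hasDerivAt_id x).const_mul (q : ℝ)
  have h := ((hasDerivAt_id x).mul (h1.log (by positivity))).sub
    (((hasDerivAt_id x).mul (hasDerivAt_id x)).const_mul (β / 2))
  refine h.congr_deriv ?_
  simp only [id]
  rw [Real.log_mul hq hx.ne']
  field_simp
  ring

/-- Moving mass t from a positive component to a zero one changes the energy by t (log t + O(1)),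
which is negative for small t. -/
lemma pos_of_mem_canonicalMacrostates {q : ℕ} [NeZero q] {β : ℝ} {ν : Fin q → ℝ}
    (hν : ν ∈ canonicalMacrostates q β) (i : Fin q) : 0 < ν i := by
  have hq : (q : ℝ) ≠ 0 := NeZero.ne _
  refine (hν.1.1 i).lt_of_ne' fun hi => ?_
  obtain ⟨j, -, hj⟩ : ∃ j ∈ Finset.univ, 0 < ν j := by
    apply Finset.exists_lt_of_sum_lt (f := fun _ => (0 : ℝ))
    rw [hν.1.2]
    simp
  have hij : i ≠ j := by
    rintro rfl
    exact hj.ne' hi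
  set d := Real.log q + 1 + (Real.log (ν j) - β * ν j)
  have h1 : HasDerivAt (fun t => siteEnergy q β (ν j - t)) (-d) 0 := by
    refine HasDerivAt.comp_const_sub (ν j) 0 ?_
    rw [sub_zero]
    exact hasDerivAt_siteEnergy β hj
  have h2 := (hasDerivAt_iff_tendsto_slope_zero.1 h1).mono_left (nhdsGT_le_nhdsNE 0)
  have h3 : Tendsto (fun t : ℝ => Real.log q + Real.log t - β / 2 * t) (𝓝[>] 0) atBot := by
    have ha : Tendsto (fun t : ℝ => Real.log q - β / 2 * t) (𝓝[>] 0) (𝓝 (Real.log q - β / 2 * 0)) :=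
      ((by fun_prop : Continuous fun t : ℝ => Real.log q - β / 2 * t).tendsto 0).mono_left
        nhdsWithin_le_nhds
    refine (ha.add_atBot Real.tendsto_log_nhdsGT_zero).congr fun t => by ring
  have h4 := h3.atBot_add h2
  have h5 : ∀ᶠ t : ℝ in 𝓝[>] 0, t < ν j := mem_nhdsWithin_of_mem_nhds (Iio_mem_nhds hj)
  obtain ⟨t, ht, htj, ht0⟩ :=
    ((h4.eventually_lt_atBot 0).and (h5.and self_mem_nhdsWithin)).exists
  have ht0 : 0 < t := ht0
  have h := siteEnergy_add_le_of_mem hν hij (t := t) (by rw [hi]; linarith) (by linarith)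
  have e0 : siteEnergy q β 0 = 0 := by simp [siteEnergy]
  have e1 : siteEnergy q β t = t * (Real.log q + Real.log t - β / 2 * t) := by
    rw [siteEnergy, Real.log_mul hq ht0.ne']
    ring
  rw [hi, zero_add, e0, e1] at h
  simp only [zero_add, sub_zero, smul_eq_mul] at ht
  have := mul_neg_of_pos_of_neg ht0 ht
  rw [mul_add, mul_inv_cancel_left₀ ht0.ne'] at this
  linarith

lemma log_sub_eq_of_mem {q : ℕ} [NeZero q] {β : ℝ} {ν : Fin q → ℝ}
    (hν : ν ∈ canonicalMacrostates q β) (i j : Fin q) :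
    Real.log (ν i) - β * ν i = Real.log (ν j) - β * ν j := by
  rcases eq_or_ne i j with rfl | hij
  · rfl
  have hi := pos_of_mem_canonicalMacrostates hν i
  have hj := pos_of_mem_canonicalMacrostates hν j
  have h1 : HasDerivAt (fun t => siteEnergy q β (ν i + t))
      (Real.log q + 1 + (Real.log (ν i) - β * ν i)) 0 := by
    refine HasDerivAt.comp_const_add (ν i) 0 ?_
    rw [add_zero]
    exact hasDerivAt_siteEnergy β hi
  have h2 : HasDerivAt (fun t => siteEnergy q β (ν j - t))
      (-(Real.log q + 1 + (Real.log (ν j) - β * ν j))) 0 := by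
    refine HasDerivAt.comp_const_sub (ν j) 0 ?_
    rw [sub_zero]
    exact hasDerivAt_siteEnergy β hj
  have hmin : IsLocalMin (fun t => siteEnergy q β (ν i + t) + siteEnergy q β (ν j - t)) 0 := by
    filter_upwards [Ioo_mem_nhds (neg_lt_zero.2 hi) hj] with t ht
    simpa using siteEnergy_add_le_of_mem hν hij (t := t) (by linarith [ht.1]) (by linarith [ht.2])
  have := hmin.hasDerivAt_eq_zero (h1.add h2)
  linarith

lemma hasDerivAt_log_sub {x : ℝ} (β : ℝ) (hx : 0 < x) :
    HasDerivAt (fun x => Real.log x - β * x) (x⁻¹ - β) x := by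
  exact ((Real.hasDerivAt_log hx.ne').sub ((hasDerivAt_id x).const_mul β)).congr_deriv
    (by rw [mul_one])

lemma strictMonoOn_log_sub {β : ℝ} :
    StrictMonoOn (fun x => Real.log x - β * x) (Ioc 0 β⁻¹) := by
  apply strictMonoOn_of_deriv_pos (convex_Ioc _ _)
  · exact fun x hx => (hasDerivAt_log_sub β hx.1).continuousAt.continuousWithinAt
  · intro x hx
    rw [interior_Ioc] at hx
    rw [(hasDerivAt_log_sub β hx.1).deriv, sub_pos]
    exact (lt_inv_comm₀ hx.1 (inv_pos.1 (hx.1.trans hx.2))).1 hx.2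

lemma strictAntiOn_log_sub {β : ℝ} (hβ : 0 < β) :
    StrictAntiOn (fun x => Real.log x - β * x) (Ici β⁻¹) := by
  have h0 : ∀ x ∈ Ici β⁻¹, 0 < x := fun x hx => (inv_pos.2 hβ).trans_le hx
  apply strictAntiOn_of_deriv_neg (convex_Ici _)
  · exact fun x hx => (hasDerivAt_log_sub β (h0 x hx)).continuousAt.continuousWithinAt
  · intro x hx
    rw [interior_Ici] at hx
    have hx0 := h0 x (Ioi_subset_Ici_self hx)
    rw [(hasDerivAt_log_sub β hx0).deriv, sub_neg]
    exact (inv_lt_comm₀ hβ hx0).1 hx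

lemma strictConcaveOn_siteEnergy {q : ℕ} [NeZero q] {β : ℝ} (hβ : 0 < β) :
    StrictConcaveOn ℝ (Ici β⁻¹) (siteEnergy q β) := by
  refine StrictAntiOn.strictConcaveOn_of_deriv (convex_Ici _)
    (continuous_siteEnergy β).continuousOn ?_
  intro x hx y hy hxy
  have hx := interior_subset hx
  have hy := interior_subset hy
  rw [(hasDerivAt_siteEnergy β ((inv_pos.2 hβ).trans_le hx)).deriv,
    (hasDerivAt_siteEnergy β ((inv_pos.2 hβ).trans_le hy)).deriv]
  have := strictAntiOn_log_sub hβ hx hy hxy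
  simpa using this

/-- Two equal components above 1/β can be spread apart symmetrically until the smaller reaches 1/β;
strict concavity there makes the energy drop. -/
lemma ne_of_inv_lt_of_mem {q : ℕ} [NeZero q] {β : ℝ} (hβ : 0 < β) {ν : Fin q → ℝ}
    (hν : ν ∈ canonicalMacrostates q β) {i j : Fin q} (hij : i ≠ j) (hi : β⁻¹ < ν i) :
    ν j ≠ ν i := by
  intro hji
  have hβ' := inv_pos.2 hβ
  have h := siteEnergy_add_le_of_mem hν hij (t := ν i - β⁻¹) (by linarith) (by linarith)
  have hc := (strictConcaveOn_siteEnergy (q := q) hβ).2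
    (show ν i + (ν i - β⁻¹) ∈ Ici β⁻¹ by simp only [mem_Ici]; linarith)
    (show ν i - (ν i - β⁻¹) ∈ Ici β⁻¹ by simp only [mem_Ici]; linarith)
    (by linarith) (show (0 : ℝ) < 1 / 2 by norm_num) (show (0 : ℝ) < 1 / 2 by norm_num)
    (by norm_num)
  simp only [smul_eq_mul] at hc
  rw [show 1 / 2 * (ν i + (ν i - β⁻¹)) + 1 / 2 * (ν i - (ν i - β⁻¹)) = ν i by ring] at hc
  rw [hji] at h
  linarith

/-! ### Transposed ψ(w) and the shape of minimizers -/

lemma psi_swap (q : ℕ) [NeZero q] (w : ℝ) (i j : Fin q) :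
    psi q w (Equiv.swap 0 i j) =
      if j = i then (1 + ((q : ℝ) - 1) * w) / q else (1 - w) / q := by
  have : Equiv.swap 0 i j = 0 ↔ j = i := by
    rw [Equiv.swap_apply_eq_iff, Equiv.swap_apply_left]
  simp only [psi, this]

lemma sum_comp_psi_swap (q : ℕ) [NeZero q] (g : ℝ → ℝ) (w : ℝ) (i : Fin q) :
    ∑ j, g (psi q w (Equiv.swap 0 i j)) =
      g ((1 + ((q : ℝ) - 1) * w) / q) + ((q : ℝ) - 1) * g ((1 - w) / q) := by
  simp only [psi_swap]
  rw [← Finset.add_sum_erase _ _ (Finset.mem_univ i), if_pos rfl]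
  have : ∑ k ∈ Finset.univ.erase i,
      g (if k = i then (1 + ((q : ℝ) - 1) * w) / q else (1 - w) / q)
      = ∑ k ∈ Finset.univ.erase i, g ((1 - w) / q) :=
    Finset.sum_congr rfl fun k hk => by rw [if_neg (Finset.ne_of_mem_erase hk)]
  rw [this, Finset.sum_const, Finset.card_erase_of_mem (Finset.mem_univ i), Finset.card_univ,
    Fintype.card_fin, nsmul_eq_mul, Nat.cast_sub (Nat.one_le_iff_ne_zero.2 (NeZero.ne q)),
    Nat.cast_one]

lemma psi_swap_mem_stdSimplex {q : ℕ} [NeZero q] {w : ℝ} (hw0 : 0 ≤ w) (hw1 : w ≤ 1) (i : Fin q) :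
    (fun j => psi q w (Equiv.swap 0 i j)) ∈ stdSimplex ℝ (Fin q) := by
  have hq : (q : ℝ) ≠ 0 := NeZero.ne _
  have hq1 : (1 : ℝ) ≤ q := by exact_mod_cast Nat.one_le_iff_ne_zero.2 (NeZero.ne q)
  refine ⟨fun j => ?_, ?_⟩
  · have : 0 ≤ ((q : ℝ) - 1) * w := mul_nonneg (by linarith) hw0
    simp only [psi_swap]
    split_ifs <;> apply div_nonneg <;> linarith
  · have := sum_comp_psi_swap q id w i
    simp only [id] at this
    rw [this]
    field_simp
    ring

lemma freeEnergy_uniformVec (q : ℕ) [NeZero q] (β : ℝ) :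
    freeEnergy q β (uniformVec q) = -(β / (2 * q)) := by
  have hq : (q : ℝ) ≠ 0 := NeZero.ne _
  simp [freeEnergy, relEntropy, uniformVec, hq]
  field_simp

lemma freeEnergy_psi_swap (q : ℕ) [NeZero q] (β w : ℝ) (i : Fin q) :
    freeEnergy q β (fun j => psi q w (Equiv.swap 0 i j)) =
      freeEnergy q β (uniformVec q) + profile q β w := by
  have hq : (q : ℝ) ≠ 0 := NeZero.ne _
  rw [freeEnergy_eq_sum, sum_comp_psi_swap, freeEnergy_uniformVec, profile, siteEnergy, siteEnergy,
    mul_div_cancel₀ _ hq, mul_div_cancel₀ _ hq]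
  field_simp
  ring

/-- A minimizer is uniform or, up to a transposition, of the form `ψ(w)` with `w` a positive
solution of the mean-field equation. -/
lemma eq_uniformVec_or_psi_of_mem {q : ℕ} [NeZero q] (hq : 3 ≤ q) {β : ℝ} (hβ : 0 < β)
    {ν : Fin q → ℝ} (hν : ν ∈ canonicalMacrostates q β) :
    ν = uniformVec q ∨ ∃ i, ∃ w : ℝ, 0 < w ∧ w < 1 ∧ betaOf q w = β ∧
      ν = fun j => psi q w (Equiv.swap 0 i j) := by
  have hr := two_lt_cast hq
  have hq0 : (q : ℝ) ≠ 0 := NeZero.ne _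
  have hpos := pos_of_mem_canonicalMacrostates hν
  have hcrit := log_sub_eq_of_mem hν
  by_cases hall : ∀ i, ν i ≤ β⁻¹
  · left
    have heq : ∀ j, ν j = ν 0 := fun j =>
      strictMonoOn_log_sub.injOn ⟨hpos j, hall j⟩ ⟨hpos 0, hall 0⟩ (hcrit j 0)
    have hsum := hν.1.2
    simp only [heq, Finset.sum_const, Finset.card_univ, Fintype.card_fin, nsmul_eq_mul] at hsum
    funext j
    rw [heq, uniformVec, eq_div_iff hq0]
    linarith
  · right
    push Not at hall
    obtain ⟨i, hi⟩ := hall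
    have hlt : ∀ j, j ≠ i → ν j < β⁻¹ := by
      intro j hj
      by_contra! h
      exact ne_of_inv_lt_of_mem hβ hν hj.symm hi
        ((strictAntiOn_log_sub hβ).injOn h hi.le (hcrit j i))
    have : Nontrivial (Fin q) := Fin.nontrivial_iff_two_le.2 (by omega)
    obtain ⟨k, hk⟩ := exists_ne i
    have heq : ∀ j, j ≠ i → ν j = ν k := fun j hj =>
      strictMonoOn_log_sub.injOn ⟨hpos j, (hlt j hj).le⟩ ⟨hpos k, (hlt k hk).le⟩ (hcrit j k)
    have hsum : ν i + ((q : ℝ) - 1) * ν k = 1 := by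
      have hs := hν.1.2
      rw [← Finset.add_sum_erase _ _ (Finset.mem_univ i),
        Finset.sum_congr rfl fun j hj => heq j (Finset.ne_of_mem_erase hj), Finset.sum_const,
        Finset.card_erase_of_mem (Finset.mem_univ i), Finset.card_univ, Fintype.card_fin,
        nsmul_eq_mul, Nat.cast_sub (by omega), Nat.cast_one] at hs
      exact hs
    have hki : ν k < ν i := (hlt k hk).trans hi
    -- The parameter w = 1 - qν_k is forced by (1-w)/q = ν_k.
    have hw0 : 0 < 1 - q * ν k := by linarith
    have hw1 : 1 - q * ν k < 1 := by
      have : 0 < q * ν k := mul_pos (by linarith) (hpos k)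
      linarith
    have e1 : 1 + ((q : ℝ) - 1) * (1 - q * ν k) = q * ν i := by
      linear_combination (-(q : ℝ)) * hsum
    have e2 : 1 - (1 - q * ν k) = q * ν k := by ring
    refine ⟨i, 1 - q * ν k, hw0, hw1, ?_, ?_⟩
    · rw [betaOf, div_eq_iff hw0.ne', logRatio, e1, e2, Real.log_mul hq0 (hpos i).ne',
        Real.log_mul hq0 (hpos k).ne']
      linear_combination hcrit i k + β * hsum
    · funext j
      rw [psi_swap, e1, e2, mul_div_cancel_left₀ _ hq0, mul_div_cancel_left₀ _ hq0]
      split_ifs with h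
      · rw [h]
      · exact heq j h

lemma freeEnergy_orderedVec (q : ℕ) [NeZero q] (β : ℝ) (i : Fin q) (b : ℝ) :
    freeEnergy q b (orderedVec q i β) =
      freeEnergy q b (uniformVec q) + profile q b (largestSolution q β) :=
  freeEnergy_psi_swap q b _ i

lemma orderedVec_mem_stdSimplex {q : ℕ} [NeZero q] (hq : 3 ≤ q) (β : ℝ) (i : Fin q) :
    orderedVec q i β ∈ stdSimplex ℝ (Fin q) :=
  psi_swap_mem_stdSimplex (largestSolution_mem_Ico hq β).1 (largestSolution_mem_Ico hq β).2.le i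

/-! ### The three temperature regimes -/

lemma canonicalMacrostates_criticalBeta {q : ℕ} [NeZero q] (hq : 3 ≤ q) :
    canonicalMacrostates q (criticalBeta q) =
      {uniformVec q} ∪ range (fun i : Fin q => orderedVec q i (criticalBeta q)) := by
  have hr := two_lt_cast hq
  have hc := profile_critW hr (criticalBeta_mul hq)
  have hsub : canonicalMacrostates q (criticalBeta q) ⊆
      {uniformVec q} ∪ range (fun i : Fin q => orderedVec q i (criticalBeta q)) := by
    intro ν hν
    rcases eq_uniformVec_or_psi_of_mem hq (criticalBeta_pos hq) hν with h | ⟨i, w, h0, h1, -, rfl⟩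
    · exact Or.inl h
    · right
      refine ⟨i, ?_⟩
      have hle := hν.2 _ (uniformVec_mem_stdSimplex q)
      rw [freeEnergy_psi_swap] at hle
      have hw : w = ((q : ℝ) - 2) / ((q : ℝ) - 1) := by
        by_contra hne
        linarith [profile_pos hr (criticalBeta_mul hq) h0 h1 hne]
      funext j
      simp only [orderedVec, largestSolution_criticalBeta hq, hw]
  have henergy : ∀ ν ∈ {uniformVec q} ∪ range (fun i : Fin q => orderedVec q i (criticalBeta q)),
      ν ∈ stdSimplex ℝ (Fin q) ∧
        freeEnergy q (criticalBeta q) ν = freeEnergy q (criticalBeta q) (uniformVec q) := by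
    rintro ν (rfl | ⟨i, rfl⟩)
    · exact ⟨uniformVec_mem_stdSimplex q, rfl⟩
    · refine ⟨orderedVec_mem_stdSimplex hq _ i, ?_⟩
      simp only [freeEnergy_orderedVec]
      rw [largestSolution_criticalBeta hq, hc, add_zero]
  -- All candidates have the same energy and some minimizer is among them, so each one is a
  -- minimizer.
  refine hsub.antisymm fun μ hμ => ?_
  obtain ⟨ν, hν⟩ := canonicalMacrostates_nonempty q (criticalBeta q)
  exact mem_canonicalMacrostates_of_le hν (henergy μ hμ).1
    ((henergy μ hμ).2.trans (henergy ν (hsub hν)).2.symm).le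

lemma sum_mul_self_sub_uniformVec {q : ℕ} [NeZero q] {ν : Fin q → ℝ}
    (hν : ν ∈ stdSimplex ℝ (Fin q)) :
    ∑ i, (ν i - 1 / q) ^ 2 = ∑ i, ν i * ν i - ∑ i, uniformVec q i * uniformVec q i := by
  have hq : (q : ℝ) ≠ 0 := NeZero.ne _
  have : ∀ i, (ν i - 1 / q) ^ 2 = ν i * ν i - 2 / q * ν i + 1 / q * (1 / q) := fun i => by ring
  simp only [this, Finset.sum_add_distrib, Finset.sum_sub_distrib, ← Finset.mul_sum, hν.2,
    uniformVec, Finset.sum_const, Finset.card_univ, Fintype.card_fin, nsmul_eq_mul]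
  field_simp
  ring

/-- On the simplex ρ is the unique minimizer of ⟨ν, ν⟩, so lowering β from β_c makes the minimizer ρ
strict. The sign of β plays no role. -/
lemma canonicalMacrostates_of_lt {q : ℕ} [NeZero q] (hq : 3 ≤ q) {β : ℝ}
    (hβ : β < criticalBeta q) : canonicalMacrostates q β = {uniformVec q} := by
  have hρ : uniformVec q ∈ canonicalMacrostates q (criticalBeta q) := by
    rw [canonicalMacrostates_criticalBeta hq]
    exact Or.inl rfl
  have hlt : ∀ ν ∈ stdSimplex ℝ (Fin q), ν ≠ uniformVec q →
      freeEnergy q β (uniformVec q) < freeEnergy q β ν := by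
    intro ν hν hne
    have h1 := hρ.2 ν hν
    have h2 : 0 < ∑ i, (ν i - 1 / q) ^ 2 := by
      obtain ⟨i, hi⟩ := Function.ne_iff.1 hne
      exact Finset.sum_pos' (fun _ _ => sq_nonneg _)
        ⟨i, Finset.mem_univ i, sq_pos_of_ne_zero (sub_ne_zero.2 hi)⟩
    rw [sum_mul_self_sub_uniformVec hν] at h2
    have h3 := mul_pos (sub_pos.2 hβ) h2
    simp only [freeEnergy] at h1 ⊢
    linarith
  refine Subset.antisymm (fun ν hν => ?_) ?_
  · by_contra hne
    exact (hlt ν hν.1 hne).not_ge (hν.2 _ (uniformVec_mem_stdSimplex q))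
  · rintro ν rfl
    refine ⟨uniformVec_mem_stdSimplex q, fun μ hμ => ?_⟩
    rcases eq_or_ne μ (uniformVec q) with rfl | hne
    · exact le_rfl
    · exact (hlt μ hμ hne).le

lemma canonicalMacrostates_of_gt {q : ℕ} [NeZero q] (hq : 3 ≤ q) {β : ℝ}
    (hβ : criticalBeta q < β) :
    canonicalMacrostates q β = range (fun i : Fin q => orderedVec q i β) := by
  have hr := two_lt_cast hq
  have hc := profile_critW hr (criticalBeta_mul hq)
  have hc0 := critW_pos hr
  have hk : 0 < (β - criticalBeta q) * ((q : ℝ) - 1) / (2 * q) :=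
    div_pos (mul_pos (sub_pos.2 hβ) (by linarith)) (by linarith)
  have hsub : canonicalMacrostates q β ⊆ range (fun i : Fin q => orderedVec q i β) := by
    intro ν hν
    have hle : ∀ i : Fin q, _ := fun i =>
      hν.2 _ (psi_swap_mem_stdSimplex hc0.le (critW_lt_one hr).le i)
    simp only [freeEnergy_psi_swap] at hle
    rw [profile_eq_sub (b' := criticalBeta q), hc] at hle
    have hpos := mul_pos hk (pow_pos hc0 2)
    rcases eq_uniformVec_or_psi_of_mem hq ((criticalBeta_pos hq).trans hβ) hν with
      rfl | ⟨i, w, h0, h1, hb, rfl⟩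
    · linarith [hle 0]
    · refine ⟨i, ?_⟩
      have hcw : ((q : ℝ) - 2) / ((q : ℝ) - 1) ≤ w := by
        -- With κ the constant of `hk`, the profile at w < c exceeds -κw² > -κc², while ψ(c) attains
        -- -κc².
        by_contra! hlt
        have hp := profile_pos hr (criticalBeta_mul hq) h0 h1 hlt.ne
        have hle' := hle i
        rw [freeEnergy_psi_swap, profile_eq_sub (b' := criticalBeta q)] at hle'
        have := mul_lt_mul_of_pos_left (pow_lt_pow_left₀ hlt h0.le two_ne_zero) hk
        linarith
      funext j
      simp only [orderedVec, ← eq_largestSolution hq hβ.le ⟨hcw, h1⟩ hb]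
  refine hsub.antisymm ?_
  rintro _ ⟨i, rfl⟩
  obtain ⟨ν, hν⟩ := canonicalMacrostates_nonempty q β
  refine mem_canonicalMacrostates_of_le hν (orderedVec_mem_stdSimplex hq β i) ?_
  obtain ⟨j, rfl⟩ := hsub hν
  simp only [freeEnergy_orderedVec, le_refl]

/-! ### Distinctness, continuity and the critical vector -/

lemma injective_psi_swap {q : ℕ} [NeZero q] {w : ℝ} (hw : 0 < w) :
    Function.Injective (fun (i j : Fin q) => psi q w (Equiv.swap 0 i j)) := by
  intro i k h
  have hq : (q : ℝ) ≠ 0 := NeZero.ne _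
  by_contra hne
  have h := congrFun h i
  simp only [psi_swap, if_true, if_neg hne] at h
  rw [div_left_inj' hq] at h
  have : (q : ℝ) * w ≠ 0 := mul_ne_zero hq hw.ne'
  exact this (by linarith)

lemma psi_swap_ne_uniformVec {q : ℕ} [NeZero q] (hq : 3 ≤ q) {w : ℝ} (hw : 0 < w) (i : Fin q) :
    (fun j => psi q w (Equiv.swap 0 i j)) ≠ uniformVec q := by
  intro h
  have hr := two_lt_cast hq
  have h := congrFun h i
  simp only [psi_swap, if_true, uniformVec] at h
  rw [div_left_inj' (NeZero.ne (q : ℝ))] at h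
  have : 0 < ((q : ℝ) - 1) * w := mul_pos (by linarith) hw
  linarith

lemma continuousOn_orderedVec {q : ℕ} [NeZero q] (hq : 3 ≤ q) (i : Fin q) :
    ContinuousOn (orderedVec q i) (Ici (criticalBeta q)) := by
  have h : Continuous fun (w : ℝ) (j : Fin q) => psi q w (Equiv.swap 0 i j) := by
    refine continuous_pi fun j => ?_
    simp only [psi_swap]
    split_ifs <;> fun_prop
  exact h.comp_continuousOn (continuousOn_largestSolution hq)

lemma psi_critW {q : ℕ} [NeZero q] (hq : 3 ≤ q) :
    psi q (((q : ℝ) - 2) / ((q : ℝ) - 1)) =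
      (fun j : Fin q => if j = 0 then 1 - 1 / (q : ℝ) else 1 / ((q : ℝ) * ((q : ℝ) - 1))) := by
  have hr := two_lt_cast hq
  have h0 : (q : ℝ) ≠ 0 := NeZero.ne _
  have h1 : (q : ℝ) - 1 ≠ 0 := by linarith
  funext j
  simp only [psi]
  split_ifs <;> field_simp <;> ring

end CurieWeissPotts

theorem mainTheorem1 (q : ℕ) [NeZero q] (hq : 3 ≤ q) :
    -- the critical value is positive, so every `β ≤ 0` is subcritical
    0 < criticalBeta q ∧
    -- (a) `w(β)` is well defined for `β > 0` and lies in `[0, 1]`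
    (∀ β : ℝ, 0 < β →
      IsGreatest (meanFieldSolutions q β) (largestSolution q β) ∧
      largestSolution q β ∈ Icc (0 : ℝ) 1) ∧
    (∀ β : ℝ, criticalBeta q < β → 0 < largestSolution q β) ∧
    StrictMonoOn (largestSolution q) (Ioi (criticalBeta q)) ∧
    (∀ β : ℝ, criticalBeta q < β → DifferentiableAt ℝ (largestSolution q) β) ∧
    largestSolution q (criticalBeta q) = ((q : ℝ) - 2) / ((q : ℝ) - 1) ∧
    Tendsto (largestSolution q) atTop (𝓝 1) ∧
    -- (b) the form of the set of canonical equilibrium macrostates, for all real `β`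
    (∀ β : ℝ, β < criticalBeta q → canonicalMacrostates q β = {uniformVec q}) ∧
    canonicalMacrostates q (criticalBeta q) =
      {uniformVec q} ∪ range (fun i : Fin q => orderedVec q i (criticalBeta q)) ∧
    (∀ β : ℝ, criticalBeta q < β →
      canonicalMacrostates q β = range (fun i : Fin q => orderedVec q i β)) ∧
    -- the listed vectors are all distinct
    (∀ β : ℝ, criticalBeta q ≤ β → Function.Injective (fun i : Fin q => orderedVec q i β)) ∧
    (∀ i : Fin q, orderedVec q i (criticalBeta q) ≠ uniformVec q) ∧
    -- each of them is continuous in `β ≥ β_c`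
    (∀ i : Fin q, ContinuousOn (orderedVec q i) (Ici (criticalBeta q))) ∧
    -- the explicit form of the first vector at the critical value
    orderedVec q 0 (criticalBeta q) = psi q (largestSolution q (criticalBeta q)) ∧
    psi q (largestSolution q (criticalBeta q)) = psi q (((q : ℝ) - 2) / ((q : ℝ) - 1)) ∧
    psi q (((q : ℝ) - 2) / ((q : ℝ) - 1)) =
      (fun j : Fin q => if j = 0 then 1 - 1 / (q : ℝ) else 1 / ((q : ℝ) * ((q : ℝ) - 1))) := by
  have hr := two_lt_cast hq
  have hpos : ∀ β : ℝ, criticalBeta q ≤ β → 0 < largestSolution q β := fun β hβ =>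
    (critW_pos hr).trans_le (largestSolution_mem hq hβ).1
  refine ⟨criticalBeta_pos hq, fun β _ => ⟨isGreatest_largestSolution hq β,
    Ico_subset_Icc_self (largestSolution_mem_Ico hq β)⟩, fun β hβ => hpos β hβ.le,
    (strictMonoOn_largestSolution hq).mono Ioi_subset_Ici_self,
    fun β hβ => differentiableAt_largestSolution hq hβ, largestSolution_criticalBeta hq,
    tendsto_largestSolution hq, fun β hβ => canonicalMacrostates_of_lt hq hβ,
    canonicalMacrostates_criticalBeta hq, fun β hβ => canonicalMacrostates_of_gt hq hβ,
    fun β hβ => injective_psi_swap (hpos β hβ),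
    psi_swap_ne_uniformVec hq (hpos _ le_rfl), continuousOn_orderedVec hq, ?_,
    by rw [largestSolution_criticalBeta hq], psi_critW hq⟩
  funext j
  rw [orderedVec, Equiv.swap_self, Equiv.refl_apply]
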